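/- We work in the first-order language $\{\in,=\}$ of set theory. $\Delta_0$ formulas are those built from atomic formulas by Boolean connectives and bounded quantifiers $\forall x\in y$, $\exists x\in y$; $\Sigma_0=\Pi_0=\Delta_0$, and a $\Sigma_{k+1}$ (resp. $\Pi_{k+1}$) formula is a finite block of existential (resp. universal) quantifiers in front of a $\Pi_k$ (resp. $\Sigma_k$) formula. $\mathsf{DB}_0$ is the theory with axioms extensionality, null set, pairing, union, cartesian product and separation for $\Delta_0$ formulas (with parameters). $\mathsf{TCo}$ says that every set is an element of some transitive set. For a formula $\varphi(x,y,v)$ with parameters $v$, $\mathsf{Coll}(\varphi)$ is $$\forall v\,\forall p\,\bigl(\forall x\in p\,\exists y\,\varphi(x,y,v)\to\exists q\,\forall x\in p\,\exists y\in q\,\varphi(x,y,v)\bigr);$$ $\mathsf{Coll}(\Sigma_k)$ is the schema of all $\mathsf{Coll}(\varphi)$ with $\varphi$ a $\Sigma_k$ formula, and $\mathsf{Coll}$ is the schema for all formulas. Let $\mathcal M\subseteq\mathcal N$ be structures for this language. $\mathcal N$ is an end extension of $\mathcal M$ if $a\in M$, $b\in N$ and $\mathcal N\models b\in a$ imply $b\in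 M$. It is $\Sigma_k$-elementary if every $\Sigma_k$ formula with parameters from $M$ holds in $\mathcal M$ if and only if it holds in $\mathcal N$, and elementary if this is so for all formulas. $\mathcal N$ is taller than $\mathcal M$ if there is $c\in N$ such that $\mathcal N\models a\in c$ for every $a\in M$, and taller* if such a $c$ can be chosen with $\mathcal N\models$ "$c$ is transitive". Theorem. Let $\mathcal M$ be a countable model of $\mathsf{DB}_0+\mathsf{TCo}+\mathsf{Coll}(\Sigma_1)$. For every natural number $n\ge 0$ the following are equivalent: (1) $\mathcal M$ has a $\Sigma_{n+2}$-elementary taller* end extension; (2) $\mathcal M$ has a $\Sigma_{n+2}$-elementary taller end extension; (3) $\mathcal M\models\mathsf{Coll}(\Sigma_{n+2})$. Moreover, $\mathcal M$ has an elementary taller* end extension if and only if $\mathcal M\models\mathsf{Coll}$. -/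

import Mathlib

open FirstOrder FirstOrder.Language

universe u v

namespace SetModel

/-- The only relation symbol of the language of set theory: a binary symbol for membership. -/
inductive MemRel : ℕ → Type
  | mem : MemRel 2

/-- The first-order language of set theory (equality is a logical symbol). -/
def LSet : Language := ⟨fun _ => Empty, MemRel⟩

/-- The membership symbol. -/
abbrev memSym : LSet.Relations 2 := MemRel.mem

section Formulas

variable {α : Type} {n : ℕ}

/-- The formula `x_n ∈ s`, where `x_n` is the newest variable and `s` is an older one. -/
def newMem (s : α ⊕ Fin n) : LSet.BoundedFormula α (n + 1) :=
  memSym.boundedFormula₂ (Term.var (Sum.inr (Fin.last n))) (Term.var (Sum.map id Fin.castSucc s))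

/-- `Δ₀` formulas: built from atomic formulas by Boolean connectives and the bounded quantifiers
`∀ x ∈ s` and `∃ x ∈ s`. -/
inductive IsDelta0 : ∀ {n : ℕ}, LSet.BoundedFormula α n → Prop
  | falsum {n : ℕ} : IsDelta0 (⊥ : LSet.BoundedFormula α n)
  | atomic {n : ℕ} {φ : LSet.BoundedFormula α n} (h : φ.IsAtomic) : IsDelta0 φ
  | imp {n : ℕ} {φ ψ : LSet.BoundedFormula α n} (hφ : IsDelta0 φ) (hψ : IsDelta0 ψ) :
      IsDelta0 (φ.imp ψ)
  | ball {n : ℕ} (s : α ⊕ Fin n) {φ : LSet.BoundedFormula α (n + 1)} (h : IsDelta0 φ) :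
      IsDelta0 ((newMem s).imp φ).all
  | bex {n : ℕ} (s : α ⊕ Fin n) {φ : LSet.BoundedFormula α (n + 1)} (h : IsDelta0 φ) :
      IsDelta0 (newMem s ⊓ φ).ex

/-- The Lévy hierarchy: `IsLevy true k` are the `Σ_k` formulas and `IsLevy false k` the `Π_k`
formulas. `Σ_0 = Π_0 = Δ₀`; a `Σ_{k+1}` formula is a finite (possibly empty) block of existential
quantifiers in front of a `Π_k` formula, and dually. -/
inductive IsLevy : Bool → ℕ → ∀ {n : ℕ}, LSet.BoundedFormula α n → Prop
  | delta0 (b : Bool) {n : ℕ} {φ : LSet.BoundedFormula α n} (h : IsDelta0 φ) : IsLevy b 0 φ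
  | flip {b : Bool} {k n : ℕ} {φ : LSet.BoundedFormula α n} (h : IsLevy (!b) k φ) :
      IsLevy b (k + 1) φ
  | ex {k n : ℕ} {φ : LSet.BoundedFormula α (n + 1)} (h : IsLevy true (k + 1) φ) :
      IsLevy true (k + 1) φ.ex
  | all {k n : ℕ} {φ : LSet.BoundedFormula α (n + 1)} (h : IsLevy false (k + 1) φ) :
      IsLevy false (k + 1) φ.all

/-- `Σ_k` formulas. -/
abbrev IsSigma (k : ℕ) (φ : LSet.BoundedFormula α n) : Prop := IsLevy true k φ

end Formulas

/-- Membership in a structure for the language of set theory. -/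
def Mem {M : Type u} [LSet.Structure M] (a b : M) : Prop := Structure.RelMap memSym ![a, b]

infix:50 " ∊ " => SetModel.Mem

/-- `c` is a transitive set in the sense of the structure. -/
def IsTransSet {M : Type u} [LSet.Structure M] (c : M) : Prop := ∀ x, x ∊ c → ∀ y, y ∊ x → y ∊ c

/-- `w` is the unordered pair `{x, y}` in the sense of the structure. -/
def IsUPair {M : Type u} [LSet.Structure M] (w x y : M) : Prop := ∀ t, t ∊ w ↔ t = x ∨ t = y

/-- `z` is the Kuratowski ordered pair `(x, y) = {{x}, {x, y}}` in the sense of the structure. -/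
def IsOPair {M : Type u} [LSet.Structure M] (z x y : M) : Prop :=
  ∀ w, w ∊ z ↔ IsUPair w x x ∨ IsUPair w x y

section Theories

variable (M : Type u) [LSet.Structure M]

/-- `M` is a model of `DB₀`: extensionality, null set, pairing, union, cartesian product and
separation for `Δ₀` formulas (with parameters `v`). -/
structure DB0 : Prop where
  ext : ∀ a b : M, (∀ x, x ∊ a ↔ x ∊ b) → a = b
  null : ∃ a : M, ∀ x, ¬ x ∊ a
  pairing : ∀ a b : M, ∃ c, IsUPair c a b
  union : ∀ a : M, ∃ c, ∀ x, x ∊ c ↔ ∃ y, y ∊ a ∧ x ∊ y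
  product : ∀ a b : M, ∃ c, ∀ z, z ∊ c ↔ ∃ x, x ∊ a ∧ ∃ y, y ∊ b ∧ IsOPair z x y
  sep : ∀ (m : ℕ) (φ : LSet.BoundedFormula (Fin m) 1), IsDelta0 φ →
    ∀ (v : Fin m → M) (p : M), ∃ q, ∀ x, x ∊ q ↔ x ∊ p ∧ φ.Realize v ![x]

/-- Transitive containment: every set is an element of a transitive set. -/
def TCo : Prop := ∀ x : M, ∃ c, x ∊ c ∧ IsTransSet c

/-- The instance of collection for `φ(x, y, v)`, where `v` is a finite tuple of parameters. -/
def CollFor {m : ℕ} (φ : LSet.BoundedFormula (Fin m) 2) : Prop :=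
  ∀ (v : Fin m → M) (p : M), (∀ x, x ∊ p → ∃ y, φ.Realize v ![x, y]) →
    ∃ q, ∀ x, x ∊ p → ∃ y, y ∊ q ∧ φ.Realize v ![x, y]

/-- The schema `Coll(Σ_k)`. -/
def CollSigma (k : ℕ) : Prop :=
  ∀ (m : ℕ) (φ : LSet.BoundedFormula (Fin m) 2), IsSigma k φ → CollFor M φ

/-- The full schema `Coll`. -/
def Coll : Prop := ∀ (m : ℕ) (φ : LSet.BoundedFormula (Fin m) 2), CollFor M φ

end Theories

section Extensions

variable {M : Type u} {N : Type v} [LSet.Structure M] [LSet.Structure N]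

/-- The extension `f : M ↪ N` is `Σ_k`-elementary. -/
def IsSigmaElementary (k : ℕ) (f : M ↪[LSet] N) : Prop :=
  ∀ (m : ℕ) (φ : LSet.Formula (Fin m)), IsSigma k φ →
    ∀ x : Fin m → M, φ.Realize (f ∘ x) ↔ φ.Realize x

/-- `N` is an end extension of `M`. -/
def IsEnd (f : M ↪[LSet] N) : Prop := ∀ (a : M) (b : N), b ∊ f a → b ∈ Set.range f

/-- `N` is taller than `M`: some element of `N` contains all elements of `M`. -/
def IsTaller (f : M ↪[LSet] N) : Prop := ∃ c : N, ∀ a : M, f a ∊ c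

/-- `N` is taller* than `M`: some transitive set of `N` contains all elements of `M`. -/
def IsTallerStar (f : M ↪[LSet] N) : Prop := ∃ c : N, (∀ a : M, f a ∊ c) ∧ IsTransSet c

end Extensions

section Existence

variable (M : Type u) [LSet.Structure M]

/-- `M` has a `Σ_k`-elementary taller end extension. -/
def HasSigmaTallerEnd (k : ℕ) : Prop :=
  ∃ (N : Type v) (_ : LSet.Structure N) (f : M ↪[LSet] N),
    IsSigmaElementary k f ∧ IsEnd f ∧ IsTaller f

/-- `M` has a `Σ_k`-elementary taller* end extension. -/
def HasSigmaTallerStarEnd (k : ℕ) : Prop :=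
  ∃ (N : Type v) (_ : LSet.Structure N) (f : M ↪[LSet] N),
    IsSigmaElementary k f ∧ IsEnd f ∧ IsTallerStar f

/-- `M` has a (fully) elementary taller* end extension. -/
def HasElementaryTallerStarEnd : Prop :=
  ∃ (N : Type v) (_ : LSet.Structure N) (f : M ↪ₑ[LSet] N),
    IsEnd f.toEmbedding ∧ IsTallerStar f.toEmbedding

end Existence

end SetModel

/-!
Fix an enumeration `e : ℕ → M`, which supplies all parameters. A block of quantifiers in front of
a conjunction can be pulled out (`LevyEq`), and under `Coll(Σ_k)` the `Σ_k` and `Π_k` relations of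
`M` are closed under bounded quantification (`boundedClosed_of_collSigma`), so that a `Σ_{k+1}`
formula needs only one unbounded existential quantifier in front of a `Π_k` formula
(`LevyDef.exists_contract`).

*Extensions yield collection* (`collSigma_of_taller`). Let `N` be a `Σ_{k+2}`-elementary taller end
extension of `M`, and let `M` satisfy `Coll(Σ_{k+1})`. If `∃ t, ρ(x, y, t)`, with `ρ` in `Π_{k+1}`,
is not collected on `p`, then for every `q` in `M` there is `x ∈ p` such that no `y, t ∈ q` satisfy
`ρ(x, y, t)`. In `M` this last condition on `x` and `q` is expressed by a `Σ_{k+1}` formula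
`θ(x, q)`. That such an `x` always exists, and that `θ` excludes witnesses in `q`, are `Π_{k+2}`
facts, so they hold in `N` too. Take for `q` an element of `N` containing all of `M`: the resulting
`x` belongs to `p`, hence to `M`, where it has witnesses, a contradiction. Induction on `k` starts
from `Coll(Σ₁)`.

*Collection yields extensions* (`exists_end_extension`). The extension is built from names
`0, 1, 2, …`, the name `0` standing for a transitive set above `M`. A condition is a property `P` of
sequences `s : ℕ → M` which is `Σ_{k+1}` definable in finitely many entries, and which is large: for
all `u` it holds for some `s` such that `s 0` is transitive and `u ∈ s 0`. A generic sequence of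
conditions and the largeness requirement generate a filter on `ℕ → M`; let `U` be an ultrafilter
extending it. The model consists of the names modulo equality of entries `U`-almost everywhere.
Since conditions provide witnesses, Łoś's theorem holds for `Σ_{k+1}` and `Π_{k+1}` formulas, and
this makes the extension `Σ_{k+2}`-elementary. It is an end extension because the condition
`s i ∈ a` can be strengthened to `s i = b` for some `b ∈ a` (`Condition.exists_mem_decided`):
otherwise each `b ∈ a` is refuted by some `u`, in the sense that `s i ≠ b` as soon as `u ∈ s 0`; this
relation of `b` and `u` is `Π_{k+1}`, so by `Coll(Σ_{k+2})` the sets `u` can be collected in a set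
`q`, and no `s` with `q ∈ s 0` and `s 0` transitive is left.

If the levels `k` of the conditions are not bounded, the same construction gives a fully elementary
extension, since every formula is equivalent to one in the Lévy hierarchy (`exists_levyEq`).
-/

namespace SetModel

/-! ### Renaming of variables -/

section Rename

variable {α β : Type} {n m : ℕ}

/-- The extension of a renaming of variables under one more quantifier; the newest variable is
sent to the newest variable. -/
def liftRenaming (g : α ⊕ Fin n → β ⊕ Fin m) : α ⊕ Fin (n + 1) → β ⊕ Fin (m + 1)
  | Sum.inl a => Sum.map id Fin.castSucc (g (Sum.inl a))
  | Sum.inr i => Fin.lastCases (motive := fun _ => β ⊕ Fin (m + 1)) (Sum.inr (Fin.last m))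
      (fun j => Sum.map id Fin.castSucc (g (Sum.inr j))) i

/-- Simultaneous renaming of the free and the bound variables of a formula. In contrast to
`BoundedFormula.relabel` a bound variable may be replaced by a free one, and no cast occurs. -/
def rename : ∀ {n m : ℕ}, (α ⊕ Fin n → β ⊕ Fin m) → LSet.BoundedFormula α n →
    LSet.BoundedFormula β m
  | _, _, _, .falsum => .falsum
  | _, _, g, .equal t₁ t₂ => .equal (t₁.relabel g) (t₂.relabel g)
  | _, _, g, .rel R ts => .rel R (fun i => (ts i).relabel g)
  | _, _, g, .imp φ ψ => .imp (rename g φ) (rename g ψ)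
  | _, _, g, .all φ => .all (rename (liftRenaming g) φ)

/-- The renaming that makes room for a new innermost quantifier. -/
def weaken : α ⊕ Fin n → α ⊕ Fin (n + 1) := Sum.map id Fin.castSucc

theorem elim_snoc_liftRenaming {S : Type u} (g : α ⊕ Fin n → β ⊕ Fin m) (v : β → S)
    (xs : Fin m → S) (x : S) (i : α ⊕ Fin (n + 1)) :
    Sum.elim v (Fin.snoc xs x : Fin (m + 1) → S) (liftRenaming g i) =
      Sum.elim (fun a => Sum.elim v xs (g (Sum.inl a)))
        (Fin.snoc (fun j => Sum.elim v xs (g (Sum.inr j))) x : Fin (n + 1) → S) i := by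
  have key : ∀ s : β ⊕ Fin m, Sum.elim v (Fin.snoc xs x : Fin (m + 1) → S)
      (Sum.map id Fin.castSucc s) = Sum.elim v xs s := by
    rintro (b | j) <;> simp
  rcases i with a | i
  · simp [liftRenaming, key]
  · induction i using Fin.lastCases with
    | last => simp [liftRenaming]
    | cast j => simp [liftRenaming, key]

theorem realize_rename {S : Type u} [LSet.Structure S] : ∀ {n m : ℕ}
    (g : α ⊕ Fin n → β ⊕ Fin m) (φ : LSet.BoundedFormula α n) (v : β → S) (xs : Fin m → S),
    (rename g φ).Realize v xs ↔ φ.Realize (fun a => Sum.elim v xs (g (Sum.inl a)))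
      (fun j => Sum.elim v xs (g (Sum.inr j)))
  | _, _, _, .falsum, _, _ => Iff.rfl
  | _, _, g, .equal t₁ t₂, v, xs => by
      simp only [rename, BoundedFormula.Realize, Term.realize_relabel]
      have : (Sum.elim v xs ∘ g) = Sum.elim (fun a => Sum.elim v xs (g (Sum.inl a)))
        (fun j => Sum.elim v xs (g (Sum.inr j))) := by
        funext i; rcases i with i | i <;> rfl
      rw [this]
  | _, _, g, .rel R ts, v, xs => by
      simp only [rename, BoundedFormula.Realize, Term.realize_relabel]
      have : (Sum.elim v xs ∘ g) = Sum.elim (fun a => Sum.elim v xs (g (Sum.inl a)))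
        (fun j => Sum.elim v xs (g (Sum.inr j))) := by
        funext i; rcases i with i | i <;> rfl
      rw [this]
  | _, _, g, .imp φ ψ, v, xs => by
      simp only [rename, BoundedFormula.realize_imp, realize_rename g φ, realize_rename g ψ]
  | _, _, g, .all φ, v, xs => by
      simp only [rename, BoundedFormula.realize_all, realize_rename (liftRenaming g) φ,
        elim_snoc_liftRenaming, Sum.elim_inl, Sum.elim_inr]

@[simp] theorem elim_snoc_weaken {S : Type u} (v : α → S) (xs : Fin n → S) (x : S)
    (i : α ⊕ Fin n) :
    Sum.elim v (Fin.snoc xs x : Fin (n + 1) → S) (weaken i) = Sum.elim v xs i := by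
  rcases i with a | j <;> simp [weaken]

@[simp] theorem realize_rename_weaken_comp {S : Type u} [LSet.Structure S]
    (g : α ⊕ Fin n → β ⊕ Fin m) (φ : LSet.BoundedFormula α n) (v : β → S) (xs : Fin m → S)
    (x : S) : (rename (weaken ∘ g) φ).Realize v (Fin.snoc xs x : Fin (m + 1) → S) ↔
      (rename g φ).Realize v xs := by
  simp [realize_rename]

@[simp] theorem realize_rename_weaken {S : Type u} [LSet.Structure S]
    (φ : LSet.BoundedFormula α n) (v : α → S) (xs : Fin n → S) (x : S) :
    (rename weaken φ).Realize v (Fin.snoc xs x : Fin (n + 1) → S) ↔ φ.Realize v xs := by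
  simp [realize_rename]

theorem rename_newMem (g : α ⊕ Fin n → β ⊕ Fin m) (s : α ⊕ Fin n) :
    rename (liftRenaming g) (newMem s) = newMem (g s) := by
  have h1 : liftRenaming g (Sum.inr (Fin.last n)) = Sum.inr (Fin.last m) := by
    simp [liftRenaming]
  have h2 : liftRenaming g (Sum.map id Fin.castSucc s) = Sum.map id Fin.castSucc (g s) := by
    rcases s with a | j <;> simp [liftRenaming]
  simp only [newMem, Relations.boundedFormula₂, Relations.boundedFormula, rename]
  congr 1
  funext i
  fin_cases i
  · simp [h1]
  · simpa using h2

theorem IsDelta0.rename {φ : LSet.BoundedFormula α n} (h : IsDelta0 φ) :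
    ∀ {m : ℕ} (g : α ⊕ Fin n → β ⊕ Fin m), IsDelta0 (SetModel.rename g φ) := by
  induction h with
  | falsum => intro m g; exact .falsum
  | atomic h =>
    intro m g
    cases h with
    | equal t₁ t₂ => exact .atomic (.equal _ _)
    | rel R ts => exact .atomic (.rel _ _)
  | imp _ _ h₁ h₂ => intro m g; exact .imp (h₁ g) (h₂ g)
  | ball s _ ih =>
    intro m g
    have := IsDelta0.ball (g s) (ih (liftRenaming g))
    rwa [← rename_newMem] at this
  | bex s _ ih =>
    intro m g
    have := IsDelta0.bex (g s) (ih (liftRenaming g))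
    rwa [← rename_newMem] at this

theorem IsLevy.rename {b : Bool} {k : ℕ} {φ : LSet.BoundedFormula α n} (h : IsLevy b k φ) :
    ∀ {m : ℕ} (g : α ⊕ Fin n → β ⊕ Fin m), IsLevy b k (SetModel.rename g φ) := by
  induction h with
  | delta0 b h => intro m g; exact .delta0 b (h.rename g)
  | flip _ ih => intro m g; exact .flip (ih g)
  | ex _ ih => intro m g; exact .ex (ih (liftRenaming g))
  | all _ ih => intro m g; exact .all (ih (liftRenaming g))

theorem IsLevy.succ {b : Bool} {k : ℕ} {φ : LSet.BoundedFormula α n} (h : IsLevy b k φ) :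
    IsLevy b (k + 1) φ := by
  induction h with
  | delta0 b h => exact .flip (.delta0 _ h)
  | flip _ ih => exact .flip ih
  | ex _ ih => exact .ex ih
  | all _ ih => exact .all ih

theorem IsLevy.mono {b : Bool} {k l : ℕ} {φ : LSet.BoundedFormula α n} (h : IsLevy b k φ)
    (hkl : k ≤ l) : IsLevy b l φ := by
  induction hkl with
  | refl => exact h
  | step _ ih => exact ih.succ

theorem IsLevy.isDelta0 {b : Bool} {φ : LSet.BoundedFormula α n} (h : IsLevy b 0 φ) :
    IsDelta0 φ := by
  cases h with
  | delta0 _ h => exact h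

/-- The truth value of a formula depends on finitely many of its free variables. -/
theorem exists_realize_congr (φ : LSet.BoundedFormula ℕ n) :
    ∃ K : ℕ, ∀ {S : Type u} [LSet.Structure S] (v w : ℕ → S), (∀ i < K, v i = w i) →
      ∀ xs, φ.Realize v xs ↔ φ.Realize w xs := by
  have hterm : ∀ {n : ℕ} (t : LSet.Term (ℕ ⊕ Fin n)), ∃ K : ℕ,
      ∀ {S : Type u} [LSet.Structure S] (v w : ℕ → S), (∀ i < K, v i = w i) →
      ∀ xs : Fin n → S, t.realize (Sum.elim v xs) = t.realize (Sum.elim w xs) := by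
    intro n t
    rcases t with (i | i) | ⟨f, _⟩
    · exact ⟨i + 1, fun v w h xs => by simpa using h i (by omega)⟩
    · exact ⟨0, fun v w h xs => by simp⟩
    · exact f.elim
  induction φ with
  | falsum => exact ⟨0, fun v w _ xs => Iff.rfl⟩
  | equal t₁ t₂ =>
    obtain ⟨K₁, h₁⟩ := hterm t₁
    obtain ⟨K₂, h₂⟩ := hterm t₂
    refine ⟨max K₁ K₂, fun v w h xs => ?_⟩
    simp only [BoundedFormula.Realize]
    rw [h₁ v w (fun i hi => h i (lt_max_of_lt_left hi)),
      h₂ v w (fun i hi => h i (lt_max_of_lt_right hi))]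
  | rel R ts =>
    choose K hK using fun i => hterm (ts i)
    refine ⟨Finset.univ.sup K, fun v w h xs => ?_⟩
    simp only [BoundedFormula.Realize]
    have : (fun i => (ts i).realize (Sum.elim v xs)) =
        fun i => (ts i).realize (Sum.elim w xs) := funext fun i =>
      hK i v w (fun j hj => h j (hj.trans_le (Finset.le_sup (Finset.mem_univ i)))) xs
    rw [this]
  | imp φ ψ h₁ h₂ =>
    obtain ⟨K₁, h₁⟩ := h₁
    obtain ⟨K₂, h₂⟩ := h₂
    refine ⟨max K₁ K₂, fun v w h xs => ?_⟩
    simp only [BoundedFormula.realize_imp]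
    rw [h₁ v w (fun i hi => h i (lt_max_of_lt_left hi)),
      h₂ v w (fun i hi => h i (lt_max_of_lt_right hi))]
  | all φ ih =>
    obtain ⟨K, hK⟩ := ih
    exact ⟨K, fun v w h xs => forall_congr' fun x => hK v w h _⟩

end Rename

/-! ### The Lévy hierarchy up to logical equivalence -/

section LevyEq

variable {α : Type} {n : ℕ}

/-- `φ` is logically equivalent to a `Σ_k` formula (`b = true`) or to a `Π_k` formula
(`b = false`). -/
def LevyEq (b : Bool) (k : ℕ) (φ : LSet.BoundedFormula α n) : Prop :=
  ∃ ψ : LSet.BoundedFormula α n, IsLevy b k ψ ∧ (ψ ⇔[(∅ : LSet.Theory)] φ)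

theorem logicalIff_of_realize {φ ψ : LSet.BoundedFormula α n}
    (h : ∀ (S : Type) [LSet.Structure S] [Nonempty S] (v : α → S) (xs : Fin n → S),
      φ.Realize v xs ↔ ψ.Realize v xs) : φ ⇔[(∅ : LSet.Theory)] ψ :=
  fun S v xs => BoundedFormula.realize_iff.2 (h S v xs)

theorem realize_of_logicalIff {φ ψ : LSet.BoundedFormula α n} (h : φ ⇔[(∅ : LSet.Theory)] ψ)
    {S : Type u} [LSet.Structure S] [Nonempty S] (v : α → S) (xs : Fin n → S) :
    φ.Realize v xs ↔ ψ.Realize v xs :=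
  h.realize_bd_iff

theorem IsLevy.levyEq {b : Bool} {k : ℕ} {φ : LSet.BoundedFormula α n} (h : IsLevy b k φ) :
    LevyEq b k φ := ⟨φ, h, logicalIff_of_realize fun _ _ _ _ _ => Iff.rfl⟩

namespace LevyEq

variable {b : Bool} {k : ℕ} {φ ψ : LSet.BoundedFormula α n}

theorem of_iff (h : LevyEq b k φ)
    (hi : ∀ (S : Type) [LSet.Structure S] [Nonempty S] (v : α → S) (xs : Fin n → S),
      φ.Realize v xs ↔ ψ.Realize v xs) : LevyEq b k ψ := by
  obtain ⟨χ, hχ, e⟩ := h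
  exact ⟨χ, hχ, logicalIff_of_realize fun S _ _ v xs =>
    (realize_of_logicalIff e v xs).trans (hi S v xs)⟩

theorem mono {l : ℕ} (h : LevyEq b k φ) (hkl : k ≤ l) : LevyEq b l φ := by
  obtain ⟨χ, hχ, e⟩ := h
  exact ⟨χ, hχ.mono hkl, e⟩

theorem flip (h : LevyEq (!b) k φ) : LevyEq b (k + 1) φ := by
  obtain ⟨χ, hχ, e⟩ := h
  exact ⟨χ, hχ.flip, e⟩

theorem ex {φ : LSet.BoundedFormula α (n + 1)} (h : LevyEq true (k + 1) φ) :
    LevyEq true (k + 1) φ.ex := by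
  obtain ⟨χ, hχ, e⟩ := h
  refine ⟨χ.ex, hχ.ex, logicalIff_of_realize fun S _ _ v xs => ?_⟩
  simp only [BoundedFormula.realize_ex, realize_of_logicalIff e]

theorem all {φ : LSet.BoundedFormula α (n + 1)} (h : LevyEq false (k + 1) φ) :
    LevyEq false (k + 1) φ.all := by
  obtain ⟨χ, hχ, e⟩ := h
  refine ⟨χ.all, hχ.all, logicalIff_of_realize fun S _ _ v xs => ?_⟩
  simp only [BoundedFormula.realize_all, realize_of_logicalIff e]

theorem alls {φ : LSet.BoundedFormula α n} (h : LevyEq false (k + 1) φ) :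
    LevyEq false (k + 1) φ.alls := by
  induction n with
  | zero => exact h
  | succ n ih => exact ih h.all

end LevyEq

theorem IsLevy.levyEq_not {b : Bool} {k : ℕ} {φ : LSet.BoundedFormula α n} (h : IsLevy b k φ) :
    LevyEq (!b) k φ.not := by
  induction h with
  | delta0 b h => exact (IsLevy.delta0 _ (h.imp .falsum)).levyEq
  | flip _ ih => exact ih.flip
  | ex _ ih => exact ih.all.of_iff fun S _ _ v xs => by simp
  | all _ ih => exact ih.ex.of_iff fun S _ _ v xs => by simp

/-- Conjunctions of `Σ_k` (or `Π_k`) formulas can be brought into prenex form. The renaming in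
front of `φ` keeps the induction on `φ` available when a quantifier of `ψ` is pulled out. -/
theorem IsLevy.levyEq_rename_inf {b : Bool} {k : ℕ} {φ : LSet.BoundedFormula α n}
    (h : IsLevy b k φ) : ∀ {m : ℕ} (g : α ⊕ Fin n → α ⊕ Fin m) {ψ : LSet.BoundedFormula α m},
      IsLevy b k ψ → LevyEq b k (SetModel.rename g φ ⊓ ψ) := by
  induction h with
  | delta0 b h =>
    intro m g ψ hψ
    exact (IsLevy.delta0 b (((h.rename g).imp (hψ.isDelta0.imp .falsum)).imp .falsum)).levyEq
  | @flip b k n φ h ih =>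
    intro m g ψ hψ
    generalize hl : k + 1 = l at hψ
    induction hψ with
    | delta0 b h => omega
    | flip hψ =>
      obtain rfl := Nat.succ.inj hl
      exact (ih g hψ).flip
    | @ex l m ψ hψ ih' =>
      obtain rfl : k = l := by omega
      refine (ih' h ih (weaken ∘ g) rfl).ex.of_iff fun S _ _ v xs => ?_
      simp
    | @all l m ψ hψ ih' =>
      obtain rfl : k = l := by omega
      refine (ih' h ih (weaken ∘ g) rfl).all.of_iff fun S _ _ v xs => ?_
      simp [forall_and]
  | ex h ih =>
    intro m g ψ hψ
    refine (ih (liftRenaming g) (hψ.rename weaken)).ex.of_iff fun S _ _ v xs => ?_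
    have : ∀ {n m} (φ : LSet.BoundedFormula α (n + 1)) (g : α ⊕ Fin n → α ⊕ Fin m),
      SetModel.rename g φ.ex = (SetModel.rename (liftRenaming g) φ).ex := fun _ _ => rfl
    simp [this]
  | all h ih =>
    intro m g ψ hψ
    refine (ih (liftRenaming g) (hψ.rename weaken)).all.of_iff fun S _ _ v xs => ?_
    have : ∀ {n m} (φ : LSet.BoundedFormula α (n + 1)) (g : α ⊕ Fin n → α ⊕ Fin m),
      SetModel.rename g φ.all = (SetModel.rename (liftRenaming g) φ).all := fun _ _ => rfl
    simp [this, forall_and]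

namespace LevyEq

variable {b : Bool} {k : ℕ} {φ ψ : LSet.BoundedFormula α n}

theorem not (h : LevyEq b k φ) : LevyEq (!b) k φ.not := by
  obtain ⟨χ, hχ, e⟩ := h
  exact hχ.levyEq_not.of_iff fun S _ _ v xs => by simp [realize_of_logicalIff e]

theorem inf (h₁ : LevyEq b k φ) (h₂ : LevyEq b k ψ) : LevyEq b k (φ ⊓ ψ) := by
  obtain ⟨χ₁, hχ₁, e₁⟩ := h₁
  obtain ⟨χ₂, hχ₂, e₂⟩ := h₂
  refine (hχ₁.levyEq_rename_inf id hχ₂).of_iff fun S _ _ v xs => ?_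
  simp [realize_of_logicalIff e₂, realize_rename, realize_of_logicalIff e₁]

theorem imp (h₁ : LevyEq (!b) k φ) (h₂ : LevyEq b k ψ) : LevyEq b k (φ.imp ψ) := by
  have := (h₁.inf h₂.not).not
  rw [Bool.not_not] at this
  exact this.of_iff fun S _ _ v xs => by simp

end LevyEq

/-- Every formula belongs to the Lévy hierarchy up to logical equivalence. -/
theorem exists_levyEq (φ : LSet.BoundedFormula α n) : ∃ k, ∀ b, LevyEq b k φ := by
  induction φ with
  | falsum => exact ⟨0, fun b => (IsLevy.delta0 b .falsum).levyEq⟩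
  | equal t₁ t₂ => exact ⟨0, fun b => (IsLevy.delta0 b (.atomic (.equal t₁ t₂))).levyEq⟩
  | rel R ts => exact ⟨0, fun b => (IsLevy.delta0 b (.atomic (.rel R ts))).levyEq⟩
  | imp φ ψ h₁ h₂ =>
    obtain ⟨k₁, h₁⟩ := h₁
    obtain ⟨k₂, h₂⟩ := h₂
    exact ⟨max k₁ k₂, fun b => ((h₁ _).mono (le_max_left _ _)).imp
      ((h₂ _).mono (le_max_right _ _))⟩
  | all φ ih =>
    obtain ⟨k, h⟩ := ih
    have h' : LevyEq false (k + 1) φ.all := ((h false).mono k.le_succ).all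
    refine ⟨k + 2, fun b => ?_⟩
    cases b
    · exact h'.mono (Nat.le_succ _)
    · exact LevyEq.flip (b := true) h'

end LevyEq

/-! ### Relations definable with parameters -/

section Definability

variable {M : Type u} [LSet.Structure M] {e : ℕ → M} {b : Bool} {k n m : ℕ}

/-- The `n`-ary relation `R` on `M` is defined by a `Σ_k` (`b = true`) or `Π_k` (`b = false`)
formula with parameters. The parameters are the values of `e : ℕ → M`, which is an enumeration of
`M` in all applications; thus the formula has its free variables in a type of universe level `0`,
as the definition of the Lévy hierarchy demands. -/
def LevyDef (e : ℕ → M) (b : Bool) (k : ℕ) (R : (Fin n → M) → Prop) : Prop :=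
  ∃ φ : LSet.BoundedFormula ℕ n, IsLevy b k φ ∧ ∀ xs, φ.Realize e xs ↔ R xs

theorem LevyEq.levyDef [Nonempty M] {φ : LSet.BoundedFormula ℕ n} (h : LevyEq b k φ)
    (e : ℕ → M) : LevyDef e b k (fun xs => φ.Realize e xs) := by
  obtain ⟨ψ, hψ, hi⟩ := h
  exact ⟨ψ, hψ, fun xs => realize_of_logicalIff hi e xs⟩

theorem IsLevy.levyDef {φ : LSet.BoundedFormula ℕ n} (h : IsLevy b k φ) (e : ℕ → M) :
    LevyDef e b k (fun xs => φ.Realize e xs) := ⟨φ, h, fun _ => Iff.rfl⟩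

@[simp] theorem realize_newMem {α : Type} (s : α ⊕ Fin n) (v : α → M) (xs : Fin n → M) (x : M) :
    (newMem s).Realize v (Fin.snoc xs x : Fin (n + 1) → M) ↔ x ∊ Sum.elim v xs s := by
  rw [newMem, BoundedFormula.realize_rel₂]
  have : Sum.elim v (Fin.snoc xs x : Fin (n + 1) → M) (Sum.map id Fin.castSucc s) =
    Sum.elim v xs s := by rcases s with a | j <;> simp
  simp [Mem, this]

namespace LevyDef

variable {R S : (Fin n → M) → Prop}

theorem congr (h : LevyDef e b k R) (hi : ∀ xs, R xs ↔ S xs) : LevyDef e b k S := by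
  obtain ⟨φ, hφ, e⟩ := h
  exact ⟨φ, hφ, fun xs => (e xs).trans (hi xs)⟩

theorem mono {l : ℕ} (h : LevyDef e b k R) (hkl : k ≤ l) : LevyDef e b l R := by
  obtain ⟨φ, hφ, e⟩ := h
  exact ⟨φ, hφ.mono hkl, e⟩

theorem flip (h : LevyDef e (!b) k R) : LevyDef e b (k + 1) R := by
  obtain ⟨φ, hφ, e⟩ := h
  exact ⟨φ, hφ.flip, e⟩

theorem of_zero {c : Bool} (h : LevyDef e c 0 R) : LevyDef e b k R := by
  obtain ⟨φ, hφ, e⟩ := h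
  exact mono ⟨φ, .delta0 b hφ.isDelta0, e⟩ k.zero_le

theorem not [Nonempty M] (h : LevyDef e b k R) : LevyDef e (!b) k (fun xs => ¬ R xs) := by
  obtain ⟨φ, hφ, hi⟩ := h
  exact (hφ.levyEq_not.levyDef e).congr fun xs => by simp [hi]

theorem and [Nonempty M] (h₁ : LevyDef e b k R) (h₂ : LevyDef e b k S) :
    LevyDef e b k (fun xs => R xs ∧ S xs) := by
  obtain ⟨φ, hφ, hi⟩ := h₁
  obtain ⟨ψ, hψ, hi'⟩ := h₂
  exact ((hφ.levyEq.inf hψ.levyEq).levyDef e).congr fun xs => by simp [hi, hi']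

theorem imp [Nonempty M] (h₁ : LevyDef e (!b) k R) (h₂ : LevyDef e b k S) :
    LevyDef e b k (fun xs => R xs → S xs) := by
  obtain ⟨φ, hφ, hi⟩ := h₁
  obtain ⟨ψ, hψ, hi'⟩ := h₂
  exact ((hφ.levyEq.imp hψ.levyEq).levyDef e).congr fun xs => by simp [hi, hi']

/-- Substitution of variables and parameters. -/
theorem subst (h : LevyDef e b k R) (t : Fin n → ℕ ⊕ Fin m) :
    LevyDef e b k (fun ys : Fin m → M => R fun i => Sum.elim e ys (t i)) := by
  obtain ⟨φ, hφ, hi⟩ := h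
  refine ⟨rename (Sum.elim Sum.inl t) φ, hφ.rename _, fun ys => ?_⟩
  rw [realize_rename]
  exact hi _

theorem comp (h : LevyDef e b k R) (g : Fin n → Fin m) :
    LevyDef e b k (fun ys : Fin m → M => R (ys ∘ g)) :=
  h.subst fun i => Sum.inr (g i)

theorem ex {R : (Fin (n + 1) → M) → Prop} (h : LevyDef e true (k + 1) R) :
    LevyDef e true (k + 1) (fun xs : Fin n → M => ∃ x, R (Fin.snoc xs x)) := by
  obtain ⟨φ, hφ, hi⟩ := h
  exact ⟨φ.ex, hφ.ex, fun xs => by simp [hi]⟩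

theorem all {R : (Fin (n + 1) → M) → Prop} (h : LevyDef e false (k + 1) R) :
    LevyDef e false (k + 1) (fun xs : Fin n → M => ∀ x, R (Fin.snoc xs x)) := by
  obtain ⟨φ, hφ, hi⟩ := h
  exact ⟨φ.all, hφ.all, fun xs => by simp [hi]⟩

/-- A block of existential quantifiers. -/
theorem exs : ∀ {l : ℕ} {R : (Fin (n + l) → M) → Prop}, LevyDef e true (k + 1) R →
    LevyDef e true (k + 1) (fun xs : Fin n → M => ∃ ys : Fin l → M, R (Fin.append xs ys))
  | 0, R, h => h.congr fun xs => by
      refine ⟨fun hR => ⟨Fin.elim0, by simpa using hR⟩, fun ⟨ys, hR⟩ => ?_⟩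
      have : Fin.append xs ys = xs := by
        funext i
        exact Fin.append_left xs ys i
      rwa [this] at hR
  | l + 1, R, h => (exs (R := fun zs : Fin (n + l) → M => ∃ x, R (Fin.snoc zs x)) h.ex).congr
      fun xs => by
        refine ⟨fun ⟨ys, x, hR⟩ => ⟨Fin.snoc ys x, ?_⟩, fun ⟨ys, hR⟩ =>
          ⟨Fin.init ys, ys (Fin.last l), ?_⟩⟩
        · rw [Fin.append_snoc]; exact hR
        · rw [← Fin.append_snoc, Fin.snoc_init_self]; exact hR

end LevyDef

theorem levyDef_mem (s t : Fin n) : LevyDef e b k (fun xs : Fin n → M => xs s ∊ xs t) := by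
  refine LevyDef.of_zero (c := b) ⟨memSym.boundedFormula₂ (Term.var (Sum.inr s))
    (Term.var (Sum.inr t)), .delta0 b (.atomic (.rel _ _)), fun xs => ?_⟩
  rw [BoundedFormula.realize_rel₂]
  simp [Mem]

theorem levyDef_eq (s t : Fin n) : LevyDef e b k (fun xs : Fin n → M => xs s = xs t) :=
  LevyDef.of_zero (c := b) ⟨(Term.var (Sum.inr s)).bdEqual (Term.var (Sum.inr t)),
    .delta0 b (.atomic (.equal _ _)), fun xs => by simp⟩

/-- The bounded quantifiers of `Δ₀` formulas. -/
theorem LevyDef.ball_zero {R : (Fin (n + 1) → M) → Prop} (h : LevyDef e b 0 R) (i : Fin n) :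
    LevyDef e b 0 (fun xs : Fin n → M => ∀ x, x ∊ xs i → R (Fin.snoc xs x)) := by
  obtain ⟨φ, hφ, hi⟩ := h
  exact ⟨_, .delta0 b (.ball (Sum.inr i) hφ.isDelta0), fun xs => by simp [hi]⟩

theorem levyDef_isTransSet (i : Fin n) :
    LevyDef e b k (fun xs : Fin n → M => IsTransSet (xs i)) := by
  have h : LevyDef e b 0 (fun xs : Fin (n + 2) → M =>
      xs (Fin.last (n + 1)) ∊ xs i.castSucc.castSucc) := levyDef_mem _ _
  refine LevyDef.of_zero (((h.ball_zero (Fin.last n)).ball_zero i).congr fun xs => ?_)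
  simp [IsTransSet]

/-- Collection for a binary relation that is `Σ_k` definable with parameters. -/
theorem LevyDef.coll (hC : CollSigma M k) {R : (Fin 2 → M) → Prop} (h : LevyDef e true k R)
    (p : M) (hp : ∀ x, x ∊ p → ∃ y, R ![x, y]) : ∃ q, ∀ x, x ∊ p → ∃ y, y ∊ q ∧ R ![x, y] := by
  obtain ⟨φ, hφ, hi⟩ := h
  obtain ⟨K, hK⟩ := exists_realize_congr φ
  -- All free variables from `K` on are replaced by the variable `0`.
  let c : ℕ → Fin (K + 1) := fun i => if h : i < K then ⟨i, by omega⟩ else 0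
  have key : ∀ xs : Fin 2 → M, (rename (Sum.map c id) φ).Realize
      (fun i : Fin (K + 1) => e i) xs ↔ R xs := fun xs => by
    rw [realize_rename, ← hi, ← hK e _ fun i hi => ?_]
    · rfl
    · simp [c, hi]
  simpa only [key] using hC (K + 1) _ (hφ.rename (Sum.map c id)) (fun i => e i) p
    (by simpa only [key] using hp)

theorem CollSigma.mono {l : ℕ} (h : CollSigma M l) (hkl : k ≤ l) : CollSigma M k :=
  fun m φ hφ => h m φ (IsLevy.mono hφ hkl)

/-! ### Collection and bounded quantifiers -/

theorem DB0.nonempty (h : DB0 M) : Nonempty M := ⟨h.null.choose⟩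

/-- The `Σ_k` and the `Π_k` relations are closed under bounded universal quantification. -/
def BoundedClosed (e : ℕ → M) (k : ℕ) : Prop :=
  ∀ (b : Bool) {n : ℕ} {R : (Fin (n + 1) → M) → Prop} (i : Fin n), LevyDef e b k R →
    LevyDef e b k (fun xs : Fin n → M => ∀ x, x ∊ xs i → R (Fin.snoc xs x))

theorem BoundedClosed.bex [Nonempty M] (hB : BoundedClosed e k)
    {R : (Fin (n + 1) → M) → Prop} (i : Fin n) (h : LevyDef e b k R) :
    LevyDef e b k (fun xs : Fin n → M => ∃ x, x ∊ xs i ∧ R (Fin.snoc xs x)) := by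
  have := (hB _ i h.not).not
  rw [Bool.not_not] at this
  exact this.congr fun xs => by push Not; rfl

/-- The reindexing of tuples that removes the third entry from the end. -/
def dropThirdLast : Fin (n + 2) → Fin (n + 3) :=
  Fin.snoc (Fin.snoc (fun i : Fin n => i.castSucc.castSucc.castSucc) (Fin.last (n + 1)).castSucc :
    Fin (n + 1) → Fin (n + 3)) (Fin.last (n + 2))

theorem snoc_comp_dropThirdLast {X : Type*} (xs : Fin n → X) (w x t : X) :
    (Fin.snoc (Fin.snoc (Fin.snoc xs w : Fin (n + 1) → X) x : Fin (n + 2) → X) t :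
      Fin (n + 3) → X) ∘ dropThirdLast =
      Fin.snoc (Fin.snoc xs x : Fin (n + 1) → X) t := by
  rw [dropThirdLast, Fin.comp_snoc, Fin.comp_snoc]
  congr 1
  · congr 1
    · funext i; simp
    · simp
  · simp

/-- Contraction of quantifiers: if the `Π_k` relations are closed under bounded quantification,
then a block of existential quantifiers in front of a `Π_k` formula can be replaced by a single
one, which ranges over (sets that contain) the witnesses of the block. -/
theorem LevyDef.exists_contract (hDB : DB0 M) (hB : BoundedClosed e k)
    {R : (Fin n → M) → Prop} (h : LevyDef e true (k + 1) R) :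
    ∃ R' : (Fin (n + 1) → M) → Prop, LevyDef e false k R' ∧
      ∀ xs, R xs ↔ ∃ t, R' (Fin.snoc xs t) := by
  have := hDB.nonempty
  obtain ⟨φ, hφ, hi⟩ := h
  simp only [← hi]
  clear hi R
  generalize hb : true = b at hφ
  generalize hl : k + 1 = l at hφ
  induction hφ with
  | delta0 b h => omega
  | flip h =>
    obtain rfl := Nat.succ.inj hl
    subst hb
    exact ⟨_, (h.levyDef e).comp Fin.castSucc, fun xs => by simp [Function.comp_def]⟩
  | all h => exact absurd hb (by simp)
  | ex h ih =>
    obtain ⟨R', hR', hi⟩ := ih rfl hl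
    refine ⟨_, hB.bex (Fin.last _) (hB.bex (Fin.last _).castSucc (hR'.comp dropThirdLast)),
      fun xs => ?_⟩
    simp only [BoundedFormula.realize_ex, hi, Fin.snoc_last, Fin.snoc_castSucc,
      snoc_comp_dropThirdLast]
    constructor
    · rintro ⟨x, t, h⟩
      obtain ⟨w, hw⟩ := hDB.pairing x t
      exact ⟨w, x, (hw x).2 (Or.inl rfl), t, (hw t).2 (Or.inr rfl), h⟩
    · rintro ⟨w, x, -, t, -, h⟩
      exact ⟨x, t, h⟩

/-- `Coll(Σ_k)` makes the `Σ_k` and the `Π_k` relations closed under bounded quantification. -/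
theorem boundedClosed_of_collSigma (hDB : DB0 M) (he : Function.Surjective e) :
    ∀ {k : ℕ}, CollSigma M k → BoundedClosed e k
  | 0, _ => fun _ _ _ i h => h.ball_zero i
  | k + 1, hC => by
    have := hDB.nonempty
    have hB : BoundedClosed e k := boundedClosed_of_collSigma hDB he (hC.mono k.le_succ)
    intro b n R i h
    cases b
    · have hm : LevyDef e true (k + 1) (fun ys : Fin (n + 1) → M =>
        ys (Fin.last n) ∊ ys i.castSucc) := levyDef_mem _ _
      exact (LevyDef.imp hm h).all.congr fun xs => by simp
    · obtain ⟨R', hR', hi⟩ := h.exists_contract hDB hB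
      refine (LevyDef.ex (LevyDef.flip (hB false i.castSucc (hB.bex (Fin.last n).castSucc
        (hR'.comp dropThirdLast))))).congr fun xs => ?_
      simp only [hi, Fin.snoc_last, Fin.snoc_castSucc, snoc_comp_dropThirdLast]
      refine ⟨fun ⟨s, hs⟩ x hx => ?_, fun H => ?_⟩
      · obtain ⟨t, -, ht⟩ := hs x hx
        exact ⟨t, ht⟩
      · choose j hj using fun i => he (xs i)
        have hS := hR'.subst (m := 2)
          (Fin.snoc (Fin.snoc (fun i => Sum.inl (j i)) (Sum.inr 0) : Fin (n + 1) → ℕ ⊕ Fin 2)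
            (Sum.inr 1))
        have key : ∀ x t : M, (fun l => Sum.elim e ![x, t] ((Fin.snoc (Fin.snoc
            (fun i => Sum.inl (j i)) (Sum.inr 0) : Fin (n + 1) → ℕ ⊕ Fin 2) (Sum.inr 1) :
            Fin (n + 2) → ℕ ⊕ Fin 2) l)) = Fin.snoc (Fin.snoc xs x : Fin (n + 1) → M) t := by
          intro x t
          funext l
          induction l using Fin.lastCases with
          | last => simp
          | cast l =>
            induction l using Fin.lastCases with
            | last => simp
            | cast l => simp [hj]
        obtain ⟨s, hs⟩ := hS.flip.coll (k := k + 1) hC (xs i) fun x hx => by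
          obtain ⟨t, ht⟩ := H x hx
          exact ⟨t, by rwa [key]⟩
        refine ⟨s, fun x hx => ?_⟩
        obtain ⟨t, hts, ht⟩ := hs x hx
        exact ⟨t, hts, by rwa [key] at ht⟩

end Definability

/-! ### Taller elementary end extensions yield collection -/

section Transfer

variable {M : Type u} {N : Type v} [LSet.Structure M] [LSet.Structure N] {e : ℕ → M}
  {k n : ℕ} {f : M ↪[LSet] N}

theorem map_mem_iff (f : M ↪[LSet] N) (a b : M) : f a ∊ f b ↔ a ∊ b := by
  have h := f.map_rel memSym ![a, b]
  have : f ∘ ![a, b] = ![f a, f b] := by funext i; fin_cases i <;> rfl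
  rwa [this] at h

theorem IsSigmaElementary.mono {l : ℕ} (hf : IsSigmaElementary l f) (hkl : k ≤ l) :
    IsSigmaElementary k f := fun m φ hφ => hf m φ (IsLevy.mono hφ hkl)

/-- For `Σ_k`-elementarity it suffices to consider formulas whose parameters are the values of an
enumeration of the smaller structure. -/
theorem isSigmaElementary_of_forall (he : Function.Surjective e)
    (h : ∀ φ : LSet.BoundedFormula ℕ 0, IsSigma k φ →
      (φ.Realize (f ∘ e) default ↔ φ.Realize e default)) : IsSigmaElementary k f := by
  intro m φ hφ x
  choose j hj using fun i => he (x i)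
  have := h _ (hφ.rename (Sum.map j id))
  simp only [realize_rename, Sum.map_inl, Sum.elim_inl, Function.comp_apply, hj] at this
  have hM : (fun i => Sum.elim e default (Sum.map j id (Sum.inr i))) = (default : Fin 0 → M) :=
    Subsingleton.elim _ _
  have hN : (fun i => Sum.elim (f ∘ e) default (Sum.map j id (Sum.inr i))) =
      (default : Fin 0 → N) := Subsingleton.elim _ _
  rwa [hM, hN] at this

theorem IsSigmaElementary.realize_iff [Nonempty M] (hf : IsSigmaElementary k f)
    (he : Function.Surjective e) {b : Bool} {φ : LSet.BoundedFormula ℕ n} (hφ : LevyEq b k φ)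
    (xs : Fin n → M) : φ.Realize (f ∘ e) (f ∘ xs) ↔ φ.Realize e xs := by
  have : Nonempty N := ⟨f (Classical.arbitrary M)⟩
  have main : ∀ {φ : LSet.BoundedFormula ℕ n}, IsSigma k φ →
      (φ.Realize (f ∘ e) (f ∘ xs) ↔ φ.Realize e xs) := by
    intro φ hφ
    -- The values of `xs` become parameters, and only finitely many parameters matter.
    choose j hj using fun i => he (xs i)
    let ψ : LSet.Formula ℕ := rename (Sum.elim Sum.inl fun i => Sum.inl (j i)) φ
    obtain ⟨K, hK⟩ := exists_realize_congr.{v} ψ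
    obtain ⟨K', hK'⟩ := exists_realize_congr.{u} ψ
    let c : ℕ → Fin (K + K' + 1) := fun i => if h : i < K + K' then ⟨i, by omega⟩ else 0
    have hN : (rename (Sum.map c id) ψ).Realize (f ∘ (fun i : Fin (K + K' + 1) => e i)) default ↔
        φ.Realize (f ∘ e) (f ∘ xs) := by
      rw [realize_rename, ← hK (f ∘ e) _ fun i hi => ?_, realize_rename]
      · simp [hj, Function.comp_def]
      · have : i < K + K' := by omega
        simp [c, this]
    have hM : (rename (Sum.map c id) ψ).Realize (fun i : Fin (K + K' + 1) => e i) default ↔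
        φ.Realize e xs := by
      rw [realize_rename, ← hK' e _ fun i hi => ?_, realize_rename]
      · simp [hj]
      · have : i < K + K' := by omega
        simp [c, this]
    rw [← hN, ← hM]
    exact hf _ _ ((hφ.rename _).rename _) _
  cases b
  · obtain ⟨ψ, hψ, hi⟩ := hφ.not
    have := main hψ
    rw [realize_of_logicalIff hi, realize_of_logicalIff hi, BoundedFormula.realize_not,
      BoundedFormula.realize_not] at this
    exact not_iff_not.1 this
  · obtain ⟨ψ, hψ, hi⟩ := hφ
    have := main hψ
    rwa [realize_of_logicalIff hi, realize_of_logicalIff hi] at this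

theorem IsSigmaElementary.forall_realize [Nonempty M] (hf : IsSigmaElementary (k + 1) f)
    (he : Function.Surjective e) {φ : LSet.BoundedFormula ℕ n} (hφ : LevyEq false (k + 1) φ)
    (h : ∀ xs : Fin n → M, φ.Realize e xs) (ys : Fin n → N) : φ.Realize (f ∘ e) ys := by
  have := (hf.realize_iff he hφ.alls default).2 (BoundedFormula.realize_alls.2 h)
  rw [Subsingleton.elim (f ∘ default) default] at this
  exact BoundedFormula.realize_alls.1 this ys

/-- Reindexing of the bound variables of a formula. -/
def reindex {m : ℕ} (g : Fin n → Fin m) : LSet.BoundedFormula ℕ n → LSet.BoundedFormula ℕ m :=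
  rename (Sum.map id g)

@[simp] theorem realize_reindex {m : ℕ} (g : Fin n → Fin m) (φ : LSet.BoundedFormula ℕ n)
    (v : ℕ → M) (xs : Fin m → M) : (reindex g φ).Realize v xs ↔ φ.Realize v (xs ∘ g) :=
  realize_rename _ _ _ _

/-- The formula `x_i ∈ x_j`. -/
def memVar (i j : Fin n) : LSet.BoundedFormula ℕ n :=
  memSym.boundedFormula₂ (Term.var (Sum.inr i)) (Term.var (Sum.inr j))

@[simp] theorem realize_memVar (i j : Fin n) (v : ℕ → M) (xs : Fin n → M) :
    (memVar i j).Realize v xs ↔ xs i ∊ xs j := by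
  rw [memVar, BoundedFormula.realize_rel₂]
  simp [Mem]

/-- Suppose that no `q` in `M` collects the witnesses for some instance of `Coll(Σ_{k+2})`. Using
`Coll(Σ_{k+1})` in `M` this is a true `Π_{k+2}` statement, hence holds for a `q` in `N` that
contains all elements of `M`, and this is absurd. -/
theorem collSigma_of_taller (hDB : DB0 M) (he : Function.Surjective e)
    (hC : CollSigma M (k + 1)) (hf : IsSigmaElementary (k + 2) f) (hE : IsEnd f)
    (hT : IsTaller f) : CollSigma M (k + 2) := by
  have := hDB.nonempty
  have : Nonempty N := ⟨f (Classical.arbitrary M)⟩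
  have hB := boundedClosed_of_collSigma hDB he hC
  intro m φ hφ v p hp
  choose j hj using fun i => he (v i)
  obtain rfl : (fun i => e (j i)) = v := funext hj
  have hφ' : LevyDef e true (k + 2) (fun xs : Fin 2 → M => φ.Realize (fun i => e (j i)) xs) :=
    ⟨_, hφ.rename (Sum.map j id), fun xs => by simp [realize_rename]⟩
  obtain ⟨R, ⟨ρ, hρ, hρi⟩, hR⟩ := hφ'.exists_contract hDB hB
  have hsnoc : ∀ x y t : M, (Fin.snoc ![x, y] t : Fin 3 → M) = ![x, y, t] := fun x y t => by
    funext i; fin_cases i <;> rfl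
  have hφρ : ∀ x y, φ.Realize (fun i => e (j i)) ![x, y] ↔ ∃ t, ρ.Realize e ![x, y, t] := by
    intro x y
    simp only [hR, hρi, hsnoc]
  by_contra hq
  push Not at hq
  -- `θ(x, q)` says in `M` that `q` contains no witnesses for `x`.
  obtain ⟨θ, hθ, hθi⟩ : LevyDef e true (k + 1) (fun xs : Fin 2 → M => ∀ y, y ∊ xs 1 → ∀ t,
      t ∊ xs 1 → ¬ ρ.Realize e ![xs 0, y, t]) := by
    have h : LevyDef e true (k + 1) (fun ys : Fin 4 → M => ¬ ρ.Realize e (ys ∘ ![0, 2, 3])) :=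
      ((hρ.levyDef e).comp _).not
    refine (hB true 1 (hB true (n := 3) 1 h)).congr fun xs => ?_
    have : ∀ y t : M, (Fin.snoc (Fin.snoc xs y : Fin 3 → M) t : Fin 4 → M) ∘ ![0, 2, 3] =
      ![xs 0, y, t] := fun y t => by funext i; fin_cases i <;> rfl
    simp only [this]
    rfl
  obtain ⟨c, hc⟩ := hT
  obtain ⟨jp, hjp⟩ := he p
  have h0 : ∀ {n : ℕ} {ψ : LSet.BoundedFormula ℕ n} {l : ℕ}, ψ.IsAtomic → LevyEq true l ψ :=
    fun h => (IsLevy.delta0 true (.atomic h)).levyEq.mono (Nat.zero_le _)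
  -- Both statements below, in which the free variables are read universally, are `Π_{k+2}`:
  -- for every `q` there is `x ∈ p` with `θ(x, q)`;
  let σ : LSet.BoundedFormula ℕ 1 := BoundedFormula.ex (newMem (Sum.inl jp) ⊓ reindex ![1, 0] θ)
  have hσ : LevyEq false (k + 2) σ :=
    LevyEq.flip (b := false) (((h0 (.rel _ _)).inf (hθ.rename _).levyEq).ex)
  have hσN := hf.forall_realize he hσ fun xs => by
    obtain ⟨x, hx, H⟩ := hq (xs 0)
    refine BoundedFormula.realize_ex.2 ⟨x, ?_⟩
    rw [BoundedFormula.realize_inf, realize_newMem, realize_reindex]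
    exact ⟨by simpa [hjp] using hx, (hθi _).2 fun y hy t _ hρt => H y hy ((hφρ x y).2 ⟨t, hρt⟩)⟩
  -- there are no `x`, `q`, `y`, `t` with `θ(x, q)`, `y ∈ q`, `t ∈ q` and `ρ(x, y, t)`.
  let τ : LSet.BoundedFormula ℕ 4 := BoundedFormula.not
    ((reindex ![0, 1] θ ⊓ (memVar 2 1 ⊓ memVar 3 1)) ⊓ reindex ![0, 2, 3] ρ)
  have hτ : LevyEq false (k + 2) τ := by
    refine LevyEq.not (b := true) (LevyEq.inf (LevyEq.inf ((hθ.rename _).levyEq.mono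
      (Nat.le_succ _)) ((h0 (.rel _ _)).inf (h0 (.rel _ _)))) ?_)
    exact LevyEq.flip (b := true) (hρ.rename _).levyEq
  have hτN := hf.forall_realize he hτ fun xs => by
    simp only [τ, BoundedFormula.realize_not, BoundedFormula.realize_inf, realize_reindex,
      realize_memVar]
    rintro ⟨⟨h₁, h₂, h₃⟩, h₄⟩
    refine (hθi _).1 h₁ (xs 2) h₂ (xs 3) h₃ ?_
    convert h₄ using 1
    funext i; fin_cases i <;> rfl
  obtain ⟨x', hx'⟩ := BoundedFormula.realize_ex.1 (hσN ![c])
  rw [BoundedFormula.realize_inf, realize_newMem, realize_reindex] at hx'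
  obtain ⟨hx'p, hx'θ⟩ := hx'
  simp only [Sum.elim_inl, Function.comp_apply, hjp] at hx'p
  obtain ⟨x, rfl⟩ := hE _ _ hx'p
  obtain ⟨y, hy⟩ := hp x ((map_mem_iff f x p).1 hx'p)
  obtain ⟨t, ht⟩ := (hφρ x y).1 hy
  have htN := (hf.realize_iff he (b := true) (LevyEq.flip hρ.levyEq) ![x, y, t]).2 ht
  have := hτN ![f x, c, f y, f t]
  simp only [τ, BoundedFormula.realize_not, BoundedFormula.realize_inf, realize_reindex,
    realize_memVar] at this
  refine this ⟨⟨?_, hc y, hc t⟩, ?_⟩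
  · convert hx'θ using 1
    funext i; fin_cases i <;> rfl
  · convert htN using 1
    funext i; fin_cases i <;> rfl

end Transfer

/-! ### Conditions and generic ultrafilters -/

section Forcing

variable {M : Type u} [LSet.Structure M] {e : ℕ → M} {K : Set ℕ}

/-- A property of sequences is large if the initial entries of its sequences are arbitrarily large
transitive sets. -/
def Large (P : (ℕ → M) → Prop) : Prop := ∀ u, ∃ s, P s ∧ u ∊ s 0 ∧ IsTransSet (s 0)

/-- A large property of sequences that depends on finitely many entries, in a `Σ_{k+1}` definable
way for some `k ∈ K`. It is a finite piece of information on the model to be constructed, whose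
elements are named by the natural numbers, `0` being the name of a transitive set that contains all
elements of `M`. -/
structure Condition (e : ℕ → M) (K : Set ℕ) where
  /-- The property of sequences. -/
  pred : (ℕ → M) → Prop
  exists_levyDef : ∃ k ∈ K, ∃ (m : ℕ) (R : (Fin m → M) → Prop), LevyDef e true (k + 1) R ∧
    ∀ s, pred s ↔ R (fun i => s i)
  large : Large pred

/-- Stronger conditions are larger. -/
instance : Preorder (Condition e K) where
  le p q := ∀ s, q.pred s → p.pred s
  le_refl _ _ h := h
  le_trans _ _ _ h₁ h₂ s h := h₁ s (h₂ s h)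

/-- A condition may be strengthened by a definable property as long as it remains large. -/
theorem Condition.exists_and [Nonempty M] (p : Condition e K) {k n : ℕ} (hk : k ∈ K)
    {R : (Fin n → M) → Prop} (hR : LevyDef e true (k + 1) R) (d : Fin n → ℕ)
    (hL : Large fun s => p.pred s ∧ R (s ∘ d)) :
    ∃ q : Condition e K, ∀ s, q.pred s ↔ p.pred s ∧ R (s ∘ d) := by
  obtain ⟨l, hl, m, S, hS, hp⟩ := p.exists_levyDef
  refine ⟨⟨fun s => p.pred s ∧ R (s ∘ d), ?_, hL⟩, fun s => Iff.rfl⟩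
  let m' := max m (Finset.univ.sup d + 1)
  have hd : ∀ i, d i < m' := fun i =>
    lt_max_of_lt_right (Nat.lt_succ_of_le (Finset.le_sup (Finset.mem_univ i)))
  refine ⟨max l k, by rcases max_choice l k with h | h <;> rwa [h], m', _,
    ((hS.mono (l := max l k + 1) (by omega)).comp (Fin.castLE (le_max_left _ _))).and
      ((hR.mono (l := max l k + 1) (by omega)).comp fun i => ⟨d i, hd i⟩), fun s => ?_⟩
  rw [hp]
  rfl

/-- Density of the conditions that decide an existential statement and give a witness for it. -/
theorem Condition.exists_witness [Nonempty M] (p : Condition e K) {k n : ℕ} (hk : k ∈ K)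
    {R : (Fin (n + 1) → M) → Prop} (hR : LevyDef e true (k + 1) R) (d : Fin n → ℕ) :
    ∃ q : Condition e K, p ≤ q ∧
      ((∃ i, ∀ s, q.pred s → R (Fin.snoc (s ∘ d) (s i))) ∨
        ∃ u, ∀ s, q.pred s → u ∊ s 0 → IsTransSet (s 0) → ¬ ∃ x, R (Fin.snoc (s ∘ d) x)) := by
  by_cases hL : Large fun s => p.pred s ∧ ∃ x, R (Fin.snoc (s ∘ d) x)
  · obtain ⟨l, -, m, S, -, hp⟩ := p.exists_levyDef
    -- The witness receives a name about which nothing has been said so far.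
    let i := max m (Finset.univ.sup d) + 1
    have hid : ∀ j, d j ≠ i := fun j => by
      have : d j ≤ Finset.univ.sup d := Finset.le_sup (Finset.mem_univ j)
      omega
    have hcomp : ∀ s : ℕ → M, s ∘ (Fin.snoc d i : Fin (n + 1) → ℕ) = Fin.snoc (s ∘ d) (s i) :=
      fun s => Fin.comp_snoc _ _ _
    obtain ⟨q, hq⟩ := p.exists_and hk hR (Fin.snoc d i : Fin (n + 1) → ℕ) fun u => by
      obtain ⟨s, ⟨hs, x, hx⟩, hu⟩ := hL u
      have h0 : Function.update s i x 0 = s 0 := Function.update_of_ne (by omega) _ _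
      refine ⟨Function.update s i x, ⟨?_, ?_⟩, by rwa [h0]⟩
      · rw [hp] at hs ⊢
        convert hs using 2 with j
        exact Function.update_of_ne (by omega) _ _
      · rw [hcomp, Function.update_self]
        convert hx using 2
        funext j
        exact Function.update_of_ne (hid j) _ _
    exact ⟨q, fun s h => ((hq s).1 h).1, Or.inl ⟨i, fun s h => by
      rw [← hcomp]; exact ((hq s).1 h).2⟩⟩
  · simp only [Large, not_forall] at hL
    obtain ⟨u, hu⟩ := hL
    exact ⟨p, le_rfl, Or.inr ⟨u, fun s hs h₁ h₂ hx => hu ⟨s, ⟨hs, hx⟩, h₁, h₂⟩⟩⟩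

/-- Density of the conditions that decide whether `i` names an element of `a`, and which one.
If no `b ∈ a` were possible, then collection would bound the sets that refute them, and a
transitive set containing the bound would refute them all. -/
theorem Condition.exists_mem_decided [Nonempty M] (he : Function.Surjective e)
    (hK : ∀ k ∈ K, CollSigma M (k + 2)) (p : Condition e K) (a : M) (i : ℕ) :
    ∃ q : Condition e K, p ≤ q ∧ ((∃ b, ∀ s, q.pred s → s i = b) ∨
        ∃ u, ∀ s, q.pred s → u ∊ s 0 → IsTransSet (s 0) → ¬ s i ∊ a) := by
  obtain ⟨k, hk, m, R, hR, hp⟩ := p.exists_levyDef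
  by_cases hL : Large fun s => p.pred s ∧ s i ∊ a
  · by_cases hb : ∃ b, Large fun s => p.pred s ∧ s i = b
    · obtain ⟨b, hb⟩ := hb
      obtain ⟨j, rfl⟩ := he b
      obtain ⟨q, hq⟩ := p.exists_and hk (R := fun xs : Fin 1 → M => xs 0 = e j)
        ((levyDef_eq (n := 2) 0 1).subst ![Sum.inr 0, Sum.inl j]) (fun _ => i) hb
      exact ⟨q, fun s h => ((hq s).1 h).1, Or.inl ⟨e j, fun s h => ((hq s).1 h).2⟩⟩
    · exfalso
      let m' := max m (i + 1)
      have hm : 0 < m' := by omega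
      have hi : i < m' := by omega
      have hT : LevyDef e true (k + 1) (fun xs : Fin 2 → M =>
          ∃ s, p.pred s ∧ xs 1 ∊ s 0 ∧ IsTransSet (s 0) ∧ s i = xs 0) := by
        have h : LevyDef e true (k + 1) (fun zs : Fin (2 + m') → M =>
            R (zs ∘ (Fin.natAdd 2 ∘ Fin.castLE (le_max_left m (i + 1)))) ∧
            zs (Fin.castAdd m' 1) ∊ zs (Fin.natAdd 2 ⟨0, hm⟩) ∧
            IsTransSet (zs (Fin.natAdd 2 ⟨0, hm⟩)) ∧
            zs (Fin.natAdd 2 ⟨i, hi⟩) = zs (Fin.castAdd m' 0)) :=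
          (hR.comp _).and ((levyDef_mem _ _).and ((levyDef_isTransSet _).and (levyDef_eq _ _)))
        refine h.exs.congr fun xs => ?_
        simp only [Fin.append_left, Fin.append_right, hp]
        constructor
        · rintro ⟨ys, h₁, h₂⟩
          refine ⟨fun j => if hj : j < m' then ys ⟨j, hj⟩ else Classical.arbitrary M, ?_, ?_⟩
          · convert h₁ using 1
            funext j
            have : (j : ℕ) < m' := by omega
            simp only [this, dif_pos, Function.comp_apply, Fin.append_right]
            rfl
          · simpa [hm, hi] using h₂
        · rintro ⟨s, h₁, h₂⟩
          refine ⟨fun j => s j, ?_, h₂⟩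
          convert h₁ using 1
          funext j
          simp
      obtain ⟨q, hq⟩ := (LevyDef.flip (b := true) hT.not).coll (hK k hk) a fun b _ => by
        by_contra H
        push Not at H
        refine hb ⟨b, fun u => ?_⟩
        obtain ⟨s, h₁, h₂, h₃, h₄⟩ := H u
        exact ⟨s, ⟨h₁, h₄⟩, h₂, h₃⟩
      obtain ⟨s, ⟨hs, hsa⟩, hqs, htr⟩ := hL q
      obtain ⟨u, hu, H⟩ := hq _ hsa
      exact H ⟨s, hs, htr q hqs u hu, htr, rfl⟩
  · simp only [Large, not_forall] at hL
    obtain ⟨u, hu⟩ := hL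
    exact ⟨p, le_rfl, Or.inr ⟨u, fun s hs h₁ h₂ hx => hu ⟨s, ⟨hs, hx⟩, h₁, h₂⟩⟩⟩

/-- An ultrafilter on the sequences of elements of `M` is generic if the initial entry of almost
every sequence is a transitive set containing any given element of `M`, if true existential
statements of level `k + 1`, `k ∈ K`, about entries of the sequences are witnessed by an entry, and
if entries that are members of some `a` in `M` are almost constant. -/
structure IsGeneric (e : ℕ → M) (K : Set ℕ) (U : Ultrafilter (ℕ → M)) : Prop where
  top : ∀ u : M, ∀ᶠ s : ℕ → M in U, u ∊ s 0 ∧ IsTransSet (s 0)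
  witness : ∀ {k n : ℕ}, k ∈ K → ∀ {R : (Fin (n + 1) → M) → Prop}, LevyDef e true (k + 1) R →
    ∀ d : Fin n → ℕ, (∀ᶠ s : ℕ → M in U, ∃ x, R (Fin.snoc (s ∘ d) x)) →
      ∃ i, ∀ᶠ s : ℕ → M in U, R (Fin.snoc (s ∘ d) (s i))
  endExt : ∀ (a : M) (i : ℕ), (∀ᶠ s : ℕ → M in U, s i ∊ a) → ∃ b, ∀ᶠ s : ℕ → M in U, s i = b

instance countable_boundedFormula (n : ℕ) : Countable (LSet.BoundedFormula ℕ n) := by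
  have h₁ : ∀ l, Countable (LSet.Functions l) := fun l => inferInstanceAs (Countable Empty)
  have h₂ : ∀ l, Countable (LSet.Relations l) := fun l =>
    have : Subsingleton (MemRel l) := ⟨by rintro ⟨⟩ ⟨⟩; rfl⟩
    inferInstanceAs (Countable (MemRel l))
  have h₃ : LSet.card ≤ Cardinal.aleph0 :=
    Cardinal.mk_le_aleph0_iff.2 (inferInstanceAs (Countable ((Σ l, LSet.Functions l) ⊕ _)))
  have h₄ := BoundedFormula.card_le (L := LSet) (α := ℕ)
  have : Countable (Σ n, LSet.BoundedFormula ℕ n) := by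
    rw [← Cardinal.mk_le_aleph0_iff]
    refine h₄.trans (max_le le_rfl ?_)
    simpa using h₃
  exact (sigma_mk_injective (i := n)).countable

/-- By the Rasiowa–Sikorski lemma there is an ideal of conditions meeting the countably many dense
sets; any ultrafilter that extends it and concentrates on large transitive sets is generic. -/
theorem exists_isGeneric [Countable M] (hDB : DB0 M) (hTCo : TCo M) (he : Function.Surjective e)
    (hne : K.Nonempty) (hK : ∀ k ∈ K, CollSigma M (k + 2)) :
    ∃ U : Ultrafilter (ℕ → M), IsGeneric e K U := by
  have := hDB.nonempty
  obtain ⟨k₀, hk₀⟩ := hne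
  let p₀ : Condition e K := ⟨fun s => s 0 = s 0, ⟨k₀, hk₀, 1, _, levyDef_eq 0 0, fun s => Iff.rfl⟩,
    fun u => by
      obtain ⟨c, hc⟩ := hTCo u
      exact ⟨fun _ => c, rfl, hc⟩⟩
  let ι := (Σ n, {φ : LSet.BoundedFormula ℕ (n + 1) // ∃ k ∈ K, IsLevy true (k + 1) φ} ×
    (Fin n → ℕ)) ⊕ (M × ℕ)
  have : Encodable ι := Encodable.ofCountable ι
  let 𝒟 : ι → Order.Cofinal (Condition e K) := Sum.elim
    (fun x => ⟨{q | (∃ i, ∀ s, q.pred s → x.2.1.1.Realize e (Fin.snoc (s ∘ x.2.2) (s i))) ∨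
        ∃ u, ∀ s, q.pred s → u ∊ s 0 → IsTransSet (s 0) →
          ¬ ∃ y, x.2.1.1.Realize e (Fin.snoc (s ∘ x.2.2) y)}, fun p => by
      obtain ⟨k, hk, hφ⟩ := x.2.1.2
      obtain ⟨q, hpq, hq⟩ := p.exists_witness hk (hφ.levyDef e) x.2.2
      exact ⟨q, hq, hpq⟩⟩)
    (fun x => ⟨{q | (∃ b, ∀ s, q.pred s → s x.2 = b) ∨
        ∃ u, ∀ s, q.pred s → u ∊ s 0 → IsTransSet (s 0) → ¬ s x.2 ∊ x.1}, fun p => by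
      obtain ⟨q, hpq, hq⟩ := p.exists_mem_decided he hK x.1 x.2
      exact ⟨q, hq, hpq⟩⟩)
  let I := Order.idealOfCofinals p₀ 𝒟
  let A : I × M → Set (ℕ → M) := fun x => {s | x.1.1.pred s ∧ x.2 ∊ s 0 ∧ IsTransSet (s 0)}
  have hA : Directed (· ≥ ·) fun x => Filter.principal (A x) := by
    rintro ⟨p, u⟩ ⟨q, w⟩
    obtain ⟨r, hr, hpr, hqr⟩ := I.directed p.1 p.2 q.1 q.2
    obtain ⟨c, hc⟩ := hDB.pairing u w
    refine ⟨⟨⟨r, hr⟩, c⟩, Filter.principal_mono.2 ?_, Filter.principal_mono.2 ?_⟩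
    · rintro s ⟨h₁, h₂, h₃⟩
      exact ⟨hpr s h₁, h₃ c h₂ u ((hc u).2 (Or.inl rfl)), h₃⟩
    · rintro s ⟨h₁, h₂, h₃⟩
      exact ⟨hqr s h₁, h₃ c h₂ w ((hc w).2 (Or.inr rfl)), h₃⟩
  have : Nonempty (I × M) := ⟨⟨⟨p₀, Order.mem_idealOfCofinals p₀ 𝒟⟩, Classical.arbitrary M⟩⟩
  have hbot : (⨅ x, Filter.principal (A x)).NeBot :=
    Filter.iInf_neBot_of_directed' hA fun x => Filter.principal_neBot_iff.2 (x.1.1.large x.2)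
  let U := Ultrafilter.of (⨅ x, Filter.principal (A x))
  have hU : ∀ (p : I) (u : M), ∀ᶠ s : ℕ → M in U, p.1.pred s ∧ u ∊ s 0 ∧ IsTransSet (s 0) := fun p u =>
    (Ultrafilter.of_le _).trans (iInf_le _ (p, u)) (Filter.mem_principal_self _)
  refine ⟨U, fun u => (hU ⟨p₀, Order.mem_idealOfCofinals p₀ 𝒟⟩ u).mono fun s h => h.2, ?_, ?_⟩
  · rintro k n hk R ⟨φ, hφ, hi⟩ d hex
    obtain ⟨q, hq, hqI⟩ := Order.cofinal_meets_idealOfCofinals p₀ 𝒟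
      (Sum.inl ⟨n, ⟨φ, k, hk, hφ⟩, d⟩)
    rcases hq with ⟨i, h⟩ | ⟨u, h⟩
    · refine ⟨i, (hU ⟨q, hqI⟩ (Classical.arbitrary M)).mono fun s hs => (hi _).1 (h s hs.1)⟩
    · obtain ⟨s, ⟨x, hx⟩, hs, h₁, h₂⟩ := (hex.and (hU ⟨q, hqI⟩ u)).exists
      exact absurd ⟨x, (hi _).2 hx⟩ (h s hs h₁ h₂)
  · intro a i ha
    obtain ⟨q, hq, hqI⟩ := Order.cofinal_meets_idealOfCofinals p₀ 𝒟 (Sum.inr ⟨a, i⟩)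
    rcases hq with ⟨b, h⟩ | ⟨u, h⟩
    · exact ⟨b, (hU ⟨q, hqI⟩ (Classical.arbitrary M)).mono fun s hs => h s hs.1⟩
    · obtain ⟨s, hx, hs, h₁, h₂⟩ := (ha.and (hU ⟨q, hqI⟩ u)).exists
      exact absurd hx (h s hs h₁ h₂)

end Forcing

/-! ### The model of a generic ultrafilter -/

section GenericModel

variable {M : Type u} {e : ℕ → M} {K : Set ℕ} {U : Ultrafilter (ℕ → M)}

/-- Two names are identified if the corresponding entries of almost all sequences agree. -/
def nameSetoid (U : Ultrafilter (ℕ → M)) : Setoid (ULift.{v} ℕ) where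
  r i j := ∀ᶠ s : ℕ → M in U, s i.down = s j.down
  iseqv := ⟨fun _ => .of_forall fun _ => rfl, fun h => h.mono fun _ => Eq.symm,
    fun h₁ h₂ => (h₁.and h₂).mono fun _ h => h.1.trans h.2⟩

/-- The model named by the natural numbers: the part of the ultrapower `M ^ (ℕ → M) / U` that
consists of the evaluation maps `s ↦ s i`. -/
def GenericModel (U : Ultrafilter (ℕ → M)) : Type v := Quotient (nameSetoid.{u, v} U)

namespace GenericModel

/-- The element with a given name. -/
def mk (U : Ultrafilter (ℕ → M)) (i : ℕ) : GenericModel.{u, v} U := Quotient.mk _ ⟨i⟩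

theorem mk_surjective : Function.Surjective (mk.{u, v} U) := by
  rintro ⟨⟨i⟩⟩
  exact ⟨i, rfl⟩

theorem mk_eq_mk {i j : ℕ} : mk.{u, v} U i = mk U j ↔ ∀ᶠ s : ℕ → M in U, s i = s j :=
  Quotient.eq (r := nameSetoid.{u, v} U)

variable [LSet.Structure M]

instance : LSet.Structure (GenericModel.{u, v} U) where
  funMap f := Empty.elim f
  RelMap {_} r := match r with
    | MemRel.mem => fun xs => ∃ i j, xs 0 = mk U i ∧ xs 1 = mk U j ∧ ∀ᶠ s : ℕ → M in U, s i ∊ s j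

theorem mk_mem_mk {i j : ℕ} : mk.{u, v} U i ∊ mk U j ↔ ∀ᶠ s : ℕ → M in U, s i ∊ s j := by
  constructor
  · rintro ⟨i', j', hi, hj, h⟩
    filter_upwards [h, mk_eq_mk.1 hi, mk_eq_mk.1 hj] with s h hi hj
    rwa [hi, hj]
  · exact fun h => ⟨i, j, rfl, rfl, h⟩

/-- `φ` is true in the generic model if and only if it is almost always true in `M`. The name of
the parameter `e j` is `c j`. -/
def Los (e : ℕ → M) (U : Ultrafilter (ℕ → M)) (c : ℕ → ℕ) {n : ℕ}
    (φ : LSet.BoundedFormula ℕ n) : Prop :=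
  ∀ w : Fin n → ℕ, φ.Realize (mk.{u, v} U ∘ c) (mk U ∘ w) ↔ ∀ᶠ s : ℕ → M in U, φ.Realize e (s ∘ w)

variable {c : ℕ → ℕ} {k n : ℕ}

namespace Los

theorem falsum : Los.{u, v} e U c (⊥ : LSet.BoundedFormula ℕ n) := fun w => by
  simp [BoundedFormula.realize_bot, U.neBot.ne]

theorem imp {φ ψ : LSet.BoundedFormula ℕ n} (h₁ : Los.{u, v} e U c φ) (h₂ : Los.{u, v} e U c ψ) :
    Los.{u, v} e U c (φ.imp ψ) := fun w => by
  simp only [BoundedFormula.realize_imp, Ultrafilter.eventually_imp, h₁ w, h₂ w]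

theorem of_isAtomic (hc : ∀ j, ∀ᶠ s : ℕ → M in U, s (c j) = e j) {φ : LSet.BoundedFormula ℕ n}
    (h : φ.IsAtomic) : Los.{u, v} e U c φ := by
  intro w
  have hterm : ∀ t : LSet.Term (ℕ ⊕ Fin n), ∃ i,
      t.realize (Sum.elim (mk.{u, v} U ∘ c) (mk U ∘ w)) = mk U i ∧
        ∀ᶠ s : ℕ → M in U, t.realize (Sum.elim e (s ∘ w)) = s i := by
    rintro ((j | j) | ⟨f, _⟩)
    · exact ⟨c j, rfl, (hc j).mono fun s h => h.symm⟩
    · exact ⟨w j, rfl, .of_forall fun s => rfl⟩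
    · exact f.elim
  rcases h with ⟨t₁, t₂⟩ | ⟨R, ts⟩
  · obtain ⟨i, hi, hi'⟩ := hterm t₁
    obtain ⟨j, hj, hj'⟩ := hterm t₂
    simp only [BoundedFormula.realize_bdEqual, hi, hj, mk_eq_mk]
    refine Filter.eventually_congr ?_
    filter_upwards [hi', hj'] with s h₁ h₂
    rw [h₁, h₂]
  · cases R
    obtain ⟨i, hi, hi'⟩ := hterm (ts 0)
    obtain ⟨j, hj, hj'⟩ := hterm (ts 1)
    have hts : ∀ {S : Type _} (g : LSet.Term (ℕ ⊕ Fin n) → S),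
        (fun l => g (ts l)) = ![g (ts 0), g (ts 1)] := fun g => by
      funext l; fin_cases l <;> rfl
    have hts' : ∀ {S : Type _} (g : LSet.Term (ℕ ⊕ Fin n) → S),
        (fun l => g (ts l)) = ![g (ts 0), g (ts 1)] := fun g => by
      funext l; fin_cases l <;> rfl
    change Structure.RelMap memSym (fun l => (ts l).realize _) ↔
      ∀ᶠ s : ℕ → M in U, Structure.RelMap memSym (fun l => (ts l).realize (Sum.elim e (s ∘ w)))
    rw [hts fun t => t.realize _, hi, hj]
    refine mk_mem_mk.trans (Filter.eventually_congr ?_)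
    filter_upwards [hi', hj'] with s h₁ h₂
    rw [hts' fun t => t.realize _, h₁, h₂]
    rfl

theorem ex (hU : IsGeneric e K U) (hk : k ∈ K) {φ : LSet.BoundedFormula ℕ (n + 1)}
    (h : Los.{u, v} e U c φ) (hφ : LevyDef e true (k + 1) fun xs => φ.Realize e xs) :
    Los.{u, v} e U c φ.ex := fun w => by
  have key : ∀ i, φ.Realize (mk.{u, v} U ∘ c)
      (Fin.snoc (mk U ∘ w) (mk U i) : Fin (n + 1) → GenericModel U) ↔
        ∀ᶠ s : ℕ → M in U, φ.Realize e (Fin.snoc (s ∘ w) (s i) : Fin (n + 1) → M) := fun i => by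
    have := h (Fin.snoc w i : Fin (n + 1) → ℕ)
    simpa only [Fin.comp_snoc] using this
  simp only [BoundedFormula.realize_ex, mk_surjective.exists, key]
  exact ⟨fun ⟨i, hi⟩ => hi.mono fun s hs => ⟨_, hs⟩, hU.witness hk hφ w⟩

theorem all [Nonempty M] (hU : IsGeneric e K U) (hk : k ∈ K)
    {φ : LSet.BoundedFormula ℕ (n + 1)} (h : Los.{u, v} e U c φ)
    (hφ : LevyDef e false (k + 1) fun xs => φ.Realize e xs) : Los.{u, v} e U c φ.all := fun w => by
  have := ((h.imp falsum).ex hU hk (hφ.not.congr fun xs => by simp)).imp falsum w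
  simpa using this

end Los

theorem los_of_isDelta0 [Nonempty M] (hU : IsGeneric e K U) (hk : k ∈ K)
    (hc : ∀ j, ∀ᶠ s : ℕ → M in U, s (c j) = e j) {φ : LSet.BoundedFormula ℕ n} (h : IsDelta0 φ) :
    Los.{u, v} e U c φ := by
  induction h with
  | falsum => exact .falsum
  | atomic h => exact .of_isAtomic hc h
  | imp _ _ h₁ h₂ => exact h₁.imp h₂
  | @ball n s φ h ih =>
    have hm : (newMem s : LSet.BoundedFormula ℕ (n + 1)).IsAtomic := .rel _ _
    exact ((Los.of_isAtomic hc hm).imp ih).all hU hk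
      (((IsLevy.delta0 false (.imp (.atomic hm) h)).mono (Nat.zero_le _)).levyDef e)
  | @bex n s φ h ih =>
    have hm : (newMem s : LSet.BoundedFormula ℕ (n + 1)).IsAtomic := .rel _ _
    exact (((Los.of_isAtomic hc hm).imp (ih.imp .falsum)).imp .falsum).ex hU hk
      (((IsLevy.delta0 true (.imp (.imp (.atomic hm) (.imp h .falsum)) .falsum)).mono
        (Nat.zero_le _)).levyDef e)

theorem los_of_isLevy [Nonempty M] (hU : IsGeneric e K U) (hk : k ∈ K)
    (hc : ∀ j, ∀ᶠ s : ℕ → M in U, s (c j) = e j) {b : Bool} {l : ℕ} {φ : LSet.BoundedFormula ℕ n}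
    (h : IsLevy b l φ) : l ≤ k + 1 → Los.{u, v} e U c φ := by
  induction h with
  | delta0 b h => exact fun _ => los_of_isDelta0 hU hk hc h
  | flip _ ih => exact fun hl => ih (by omega)
  | ex h ih => exact fun hl => (ih hl).ex hU hk ((h.mono hl).levyDef e)
  | all h ih => exact fun hl => (ih hl).all hU hk ((h.mono hl).levyDef e)

/-- Truth of `Π_{k+2}` formulas passes to the generic model. -/
theorem realize_of_isLevy_false [Nonempty M] (hU : IsGeneric e K U) (hk : k ∈ K)
    (hc : ∀ j, ∀ᶠ s : ℕ → M in U, s (c j) = e j) {φ : LSet.BoundedFormula ℕ n}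
    (h : IsLevy false (k + 2) φ) : ∀ w : Fin n → ℕ, (∀ᶠ s : ℕ → M in U, φ.Realize e (s ∘ w)) →
      φ.Realize (mk.{u, v} U ∘ c) (mk U ∘ w) := by
  generalize hb : false = b at h
  generalize hl : k + 2 = l at h
  induction h with
  | delta0 b h => omega
  | flip h => exact fun w => (los_of_isLevy hU hk hc h (by omega) w).2
  | ex h => exact absurd hb (by simp)
  | @all l n φ h ih =>
    intro w hw
    rw [BoundedFormula.realize_all, mk_surjective.forall]
    intro i
    have := ih hb hl (Fin.snoc w i : Fin (n + 1) → ℕ) (hw.mono fun s hs => by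
      rw [Fin.comp_snoc]
      exact hs (s i))
    rwa [Fin.comp_snoc] at this

/-- Truth of `Σ_{k+2}` formulas with parameters in `M` passes to the generic model. -/
theorem realize_of_isLevy_true [Nonempty M] (hU : IsGeneric e K U) (hk : k ∈ K)
    {g : M → ℕ} (hg : ∀ a, ∀ᶠ s : ℕ → M in U, s (g a) = a) {φ : LSet.BoundedFormula ℕ n}
    (h : IsLevy true (k + 2) φ) : ∀ xs : Fin n → M, φ.Realize e xs →
      φ.Realize (mk.{u, v} U ∘ (g ∘ e)) (mk U ∘ (g ∘ xs)) := by
  generalize hb : true = b at h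
  generalize hl : k + 2 = l at h
  induction h with
  | delta0 b h => omega
  | flip h =>
    intro xs hxs
    refine (los_of_isLevy hU hk (fun j => hg _) h (by omega) (g ∘ xs)).2 ?_
    filter_upwards [Filter.eventually_all.2 fun i => hg (xs i)] with s hs
    have : s ∘ (g ∘ xs) = xs := funext hs
    rwa [this]
  | all h => exact absurd hb (by simp)
  | @ex l n φ h ih =>
    intro xs hxs
    obtain ⟨x, hx⟩ := BoundedFormula.realize_ex.1 hxs
    refine BoundedFormula.realize_ex.2 ⟨mk U (g x), ?_⟩
    have := ih hb hl _ hx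
    rwa [Fin.comp_snoc, Fin.comp_snoc] at this

end GenericModel

variable [LSet.Structure M]

open GenericModel in
/-- The generic model as an end extension of `M`. The bounded choice `K = {k}` yields
`Σ_{k+2}`-elementarity from `Coll(Σ_{k+2})`, and `K = univ` yields full elementarity from full
collection. -/
theorem exists_end_extension [Countable M] (hDB : DB0 M) (hTCo : TCo M) (hne : K.Nonempty)
    (hK : ∀ k ∈ K, CollSigma M (k + 2)) :
    ∃ (N : Type v) (_ : LSet.Structure N) (f : M ↪[LSet] N),
      (∀ k ∈ K, IsSigmaElementary (k + 2) f) ∧ IsEnd f ∧ IsTallerStar f := by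
  have := hDB.nonempty
  obtain ⟨e, he⟩ := exists_surjective_nat M
  obtain ⟨U, hU⟩ := exists_isGeneric hDB hTCo he hne hK
  obtain ⟨k₀, hk₀⟩ := hne
  -- Every element of `M` is named, as the value of an entry that is almost constant.
  have hname : ∀ a, ∃ i, ∀ᶠ s : ℕ → M in U, s i = a := fun a => by
    obtain ⟨j, rfl⟩ := he a
    exact hU.witness hk₀ (R := fun xs : Fin 1 → M => xs 0 = e j)
      ((levyDef_eq (n := 2) 0 1).subst ![Sum.inr 0, Sum.inl j]) Fin.elim0
      (.of_forall fun s => ⟨e j, rfl⟩)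
  choose g hg using hname
  have hmem : ∀ a b : M, mk.{u, v} U (g a) ∊ mk U (g b) ↔ a ∊ b := fun a b => by
    have : (∀ᶠ s : ℕ → M in U, s (g a) ∊ s (g b)) ↔ ∀ᶠ _ : ℕ → M in U, a ∊ b := by
      refine Filter.eventually_congr ?_
      filter_upwards [hg a, hg b] with s ha hb
      rw [ha, hb]
    rw [mk_mem_mk, this, Filter.eventually_const]
  let f : M ↪[LSet] GenericModel.{u, v} U :=
    { toFun := fun a => mk U (g a)
      inj' := fun a b h => by
        obtain ⟨s, h₁, h₂, h₃⟩ := ((mk_eq_mk.1 h).and ((hg a).and (hg b))).exists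
        rw [← h₂, ← h₃, h₁]
      map_fun' := fun r => r.elim
      map_rel' := by
        rintro _ ⟨⟩ xs
        have hx : ∀ {S : Type _} (h : M → S), h ∘ xs = ![h (xs 0), h (xs 1)] := fun h => by
          funext l; fin_cases l <;> rfl
        have hx' : xs = ![xs 0, xs 1] := by funext l; fin_cases l <;> rfl
        rw [hx, hx']
        exact hmem _ _ }
  refine ⟨GenericModel.{u, v} U, inferInstance, f, fun k hk => ?_, fun a b hb => ?_,
    mk U 0, fun a => ?_, fun x hx y hy => ?_⟩
  · refine isSigmaElementary_of_forall he fun φ hφ => ⟨fun h => ?_, fun h => ?_⟩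
    · by_contra hM
      obtain ⟨ψ, hψ, hi⟩ := hφ.levyEq_not
      have : Nonempty (GenericModel.{u, v} U) := ⟨mk U 0⟩
      have hψM : ψ.Realize e default :=
        (realize_of_logicalIff hi e default).2 (BoundedFormula.realize_not.2 hM)
      have hψN := realize_of_isLevy_false.{u, v} hU hk (c := g ∘ e) (fun j => hg _) hψ Fin.elim0
        (.of_forall fun s => by rwa [Subsingleton.elim (s ∘ Fin.elim0) default])
      rw [realize_of_logicalIff hi, BoundedFormula.realize_not] at hψN
      refine hψN ?_
      rwa [Subsingleton.elim (mk.{u, v} U ∘ Fin.elim0) default]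
    · have := realize_of_isLevy_true.{u, v} hU hk hg hφ default h
      rwa [Subsingleton.elim (mk.{u, v} U ∘ (g ∘ default)) default] at this
  · obtain ⟨i, rfl⟩ := mk_surjective b
    have hi : ∀ᶠ s : ℕ → M in U, s i ∊ a := by
      filter_upwards [mk_mem_mk.1 hb, hg a] with s h₁ h₂
      rwa [h₂] at h₁
    obtain ⟨b, hb⟩ := hU.endExt a i hi
    refine ⟨b, mk_eq_mk.2 ?_⟩
    filter_upwards [hb, hg b] with s h₁ h₂
    rw [h₁, h₂]
  · refine mk_mem_mk.2 ?_
    filter_upwards [hU.top a, hg a] with s h₁ h₂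
    rw [h₂]
    exact h₁.1
  · obtain ⟨i, rfl⟩ := mk_surjective x
    obtain ⟨j, rfl⟩ := mk_surjective y
    refine mk_mem_mk.2 ?_
    filter_upwards [mk_mem_mk.1 hx, mk_mem_mk.1 hy, hU.top (Classical.arbitrary M)] with s h₁ h₂ h₃
    exact h₃.2 _ h₁ _ h₂

end GenericModel

/-! ### The equivalences -/

section Main

variable {M : Type u} [LSet.Structure M]

theorem coll_of_forall_collSigma [Nonempty M] (h : ∀ k, CollSigma M k) : Coll M := by
  intro m φ
  obtain ⟨k, hk⟩ := exists_levyEq φ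
  obtain ⟨ψ, hψ, hi⟩ := hk true
  have := h k m ψ hψ
  simpa only [CollFor, realize_of_logicalIff hi] using this

theorem HasSigmaTallerStarEnd.hasSigmaTallerEnd {k : ℕ}
    (h : HasSigmaTallerStarEnd.{u, v} M k) : HasSigmaTallerEnd.{u, v} M k := by
  obtain ⟨N, _, f, hf, hE, c, hc, -⟩ := h
  exact ⟨N, _, f, hf, hE, c, hc⟩

theorem collSigma_of_hasSigmaTallerEnd [Countable M] (hDB : DB0 M) (hC : CollSigma M 1) :
    ∀ n : ℕ, HasSigmaTallerEnd.{u, v} M (n + 2) → CollSigma M (n + 2) := by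
  rintro n ⟨N, _, f, hf, hE, hT⟩
  have := hDB.nonempty
  obtain ⟨e, he⟩ := exists_surjective_nat M
  induction n with
  | zero => exact collSigma_of_taller hDB he hC hf hE hT
  | succ n ih => exact collSigma_of_taller hDB he (ih (hf.mono (Nat.le_succ _))) hf hE hT

theorem hasSigmaTallerStarEnd_of_collSigma [Countable M] (hDB : DB0 M) (hTCo : TCo M) {n : ℕ}
    (hC : CollSigma M (n + 2)) : HasSigmaTallerStarEnd.{u, v} M (n + 2) := by
  obtain ⟨N, _, f, hf, h⟩ := exists_end_extension.{u, v} (K := {n}) hDB hTCo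
    (Set.singleton_nonempty n) fun k hk => by rwa [Set.mem_singleton_iff.1 hk]
  exact ⟨N, _, f, hf n rfl, h⟩

theorem hasElementaryTallerStarEnd_of_coll [Countable M] (hDB : DB0 M) (hTCo : TCo M)
    (hC : Coll M) : HasElementaryTallerStarEnd.{u, v} M := by
  have := hDB.nonempty
  obtain ⟨N, _, f, hf, h⟩ := exists_end_extension.{u, v} (K := Set.univ) hDB hTCo
    Set.univ_nonempty fun k _ m φ _ => hC m φ
  have : Nonempty N := ⟨f (Classical.arbitrary M)⟩
  refine ⟨N, _, ⟨f, fun m φ x => ?_⟩, h⟩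
  obtain ⟨k, hk⟩ := exists_levyEq φ
  obtain ⟨ψ, hψ, hi⟩ := hk true
  have := hf k trivial m ψ (hψ.mono (Nat.le_add_right k 2)) x
  simpa only [Formula.Realize, realize_of_logicalIff hi] using this

theorem HasElementaryTallerStarEnd.hasSigmaTallerStarEnd
    (h : HasElementaryTallerStarEnd.{u, v} M) (k : ℕ) : HasSigmaTallerStarEnd.{u, v} M k := by
  obtain ⟨N, _, f, hf⟩ := h
  exact ⟨N, _, f.toEmbedding, fun m φ _ x => f.map_formula φ x, hf⟩

end Main

end SetModel

theorem mainTheorem6 (M : Type u) [SetModel.LSet.Structure M] [Countable M]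
    (hDB : SetModel.DB0 M) (hTCo : SetModel.TCo M) (hColl : SetModel.CollSigma M 1) :
    (∀ n : ℕ, List.TFAE
      [SetModel.HasSigmaTallerStarEnd.{u, v} M (n + 2),
       SetModel.HasSigmaTallerEnd.{u, v} M (n + 2),
       SetModel.CollSigma M (n + 2)]) ∧
    (SetModel.HasElementaryTallerStarEnd.{u, v} M ↔ SetModel.Coll M) := by
  have := hDB.nonempty
  refine ⟨fun n => ?_, fun h => ?_, SetModel.hasElementaryTallerStarEnd_of_coll hDB hTCo⟩
  · tfae_have 1 → 2 := SetModel.HasSigmaTallerStarEnd.hasSigmaTallerEnd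
    tfae_have 2 → 3 := SetModel.collSigma_of_hasSigmaTallerEnd hDB hColl n
    tfae_have 3 → 1 := SetModel.hasSigmaTallerStarEnd_of_collSigma hDB hTCo
    tfae_finish
  · refine SetModel.coll_of_forall_collSigma fun k => ?_
    exact (SetModel.collSigma_of_hasSigmaTallerEnd hDB hColl k
      (h.hasSigmaTallerStarEnd (k + 2)).hasSigmaTallerEnd).mono (Nat.le_add_right k 2)
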